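/- Let $\varphi:\mathbb R\to\mathbb R$ be differentiable with $\varphi(0)=0$ and $\varphi'(x)>0$ for all $x$, twice continuously differentiable on $\mathbb R\setminus\{0\}$, with $\varphi''(x)<0$ for $x<0$ and $\varphi''(x)>0$ for $x>0$. Let $0<g<1$ and let $T,m_0,m_T$ be real numbers with $0<\Delta m:=m_0-m_T<T$. Consider the optimal control problem on $[0,T]$ $$\dot s=x,\quad \dot x=u-\varphi(x)-g,\quad \dot m=-u,\quad 0\le u\le 1,$$ $$s(0)=0,\quad x(0)=0,\quad m(0)=m_0,\quad m(T)\ge m_T,\qquad s(T)\to\max ,$$ with absolutely continuous $s,x,m$ and measurable $u$. A Pontryagin extremal is an admissible process $(s,x,m,u)$ together with constants $(\alpha_0,\alpha,\beta_s,\beta_x,\beta_m)\ne 0$, $\alpha_0\ge0$, $\alpha\ge0$, and Lipschitz functions $\psi_s,\psi_x,\psi_m$ on $[0,T]$ such that $\alpha(m(T)-m_T)=0$; $\dot\psi_s=0$, $-\dot\psi_x=\psi_s-\psi_x\varphi'(x)$, $\dot\psi_m=0$; $\psi_s(0)=\beta_s$, $\psi_s(T)=\alpha_0$, $\psi_x(0)=\beta_x$,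 $\psi_x(T)=0$, $\psi_m(0)=\beta_m$, $\psi_m(T)=\alpha$; and the function $H=\psi_s x+\psi_x(u-\varphi(x)-g)-\psi_m u$ is constant in $t$ almost everywhere and, for almost all $t$, $u(t)$ maximizes $H$ over the control values in $[0,1]$. Then every Pontryagin extremal satisfies $\alpha_0>0$ and $\alpha>0$, and its control has (almost everywhere) one of the following five forms on consecutive nondegenerate intervals filling $]0,T[$: - Ia: $u=(1,0)$; - Ib: $u=(1,u_{sing},0)$; - IIa: $u=(0,1,0)$; - IIb: $u=(0,1,u_{sing},0)$; - III: $u=(1,0,1,0)$; where on the singular interval $\psi_x\equiv\alpha$, $x$ is constant and $u_{sing}=\varphi(x)+g$. Moreover, there are unique $x_{min},x_{max}$ with $-\varphi(x_{min})-g=0$ and $1-\varphi(x_{max})-g=0$. Put $a=\alpha/\alpha_0$ and suppose that $x^\sim\ge0$ satisfies $\varphi'(x^\sim)=1/a$. Then the type of the extremal is always among those listed for each case whose conditions hold (the table lists the types that are not excluded; it does not assert that each listed type is realized): I. $0<g<\tfrac12$. 1. $a\le\frac{x_{max}}{1-g}$: (a) $x_{max}\le x^\sim$: Ia; (b) $x_{max}>x^\sim$,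 $x_{min}\ge-x^\sim$: Ia, Ib; (c) $x_{max}>x^\sim$, $x_{min}<-x^\sim$: Ia, Ib, IIa. 2. $\frac{x_{max}}{1-g}\le a<-\frac{x_{min}}g$: (a) $x_{min}\ge-x^\sim$: Ia, Ib; (b) $x_{min}<-x^\sim$: Ia, Ib, IIa. 3. $a\ge-\frac{x_{min}}g$: Ia, Ib, IIa, IIb, III. II. $g=\tfrac12$. 1. $a\le 2x_{max}$: (a) $x_{max}<x^\sim$: Ia; (b) $x_{max}\ge x^\sim$: Ia, Ib, IIa. 2. $a>2x_{max}$: Ia, Ib, IIa, IIb, III. III. $\tfrac12<g<1$. 1. $a\le-\frac{x_{min}}g$: (a) $x_{min}\ge-x^\sim$ and $\varphi$ is odd: Ia; (b) $x_{min}<-x^\sim$, $x_{max}\le x^\sim$: Ia; (c) $x_{max}>x^\sim$: Ia, Ib. 2. $-\frac{x_{min}}g<a\le\frac{x_{max}}{1-g}$: (a) $x_{max}\le x^\sim$: Ia, IIa; (b) $x_{max}>x^\sim$: Ia, Ib, IIa, IIb, III. 3. $a>\frac{x_{max}}{1-g}$: Ia, Ib, IIa, IIb, III. Finally, if $\varphi'(0)\ge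 1/a$, then the extremal can only be of type Ia. -/

import Mathlib

open MeasureTheory Set

/-- The assumptions on the friction (media resistance) function: `φ 0 = 0`, `φ' > 0` everywhere,
`φ` is twice continuously differentiable away from `0`, `φ'' < 0` on the negative half-line and
`φ'' > 0` on the positive half-line. -/
structure IsFriction (φ : ℝ → ℝ) : Prop where
  zero : φ 0 = 0
  differentiable : Differentiable ℝ φ
  deriv_pos : ∀ x, 0 < deriv φ x
  contDiffOn : ContDiffOn ℝ 2 φ {(0 : ℝ)}ᶜ
  deriv_deriv_neg : ∀ x, x < 0 → deriv (deriv φ) x < 0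
  deriv_deriv_pos : ∀ x, 0 < x → 0 < deriv (deriv φ) x

/-- A quadruple (position, velocity, mass, thrust) of functions of time; only the values on
`[0, T]` matter. -/
structure Trajectory where
  s : ℝ → ℝ
  x : ℝ → ℝ
  m : ℝ → ℝ
  u : ℝ → ℝ

/-- The differential equation `y' = f` almost everywhere on `(0, T)`. -/
def DerivAE (T : ℝ) (y f : ℝ → ℝ) : Prop :=
  ∀ᵐ t : ℝ, t ∈ Ioo 0 T → HasDerivAt y (f t) t

/-- Admissible processes of the control problem
`s' = x`, `x' = u - φ(x) - g`, `m' = -u`, `0 ≤ u ≤ 1`,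
`s(0) = 0`, `x(0) = 0`, `m(0) = m₀`, `m(T) ≥ m_T`, with objective `s(T) → max`:
absolutely continuous state components and a measurable control. -/
structure IsAdmissible (φ : ℝ → ℝ) (g T m₀ mT : ℝ) (p : Trajectory) : Prop where
  ac_s : AbsolutelyContinuousOnInterval p.s 0 T
  ac_x : AbsolutelyContinuousOnInterval p.x 0 T
  ac_m : AbsolutelyContinuousOnInterval p.m 0 T
  measurable_u : AEMeasurable p.u (volume.restrict (Icc 0 T))
  control : ∀ᵐ t : ℝ, t ∈ Ioo 0 T → p.u t ∈ Icc (0 : ℝ) 1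
  ode_s : DerivAE T p.s p.x
  ode_x : DerivAE T p.x (fun t => p.u t - φ (p.x t) - g)
  ode_m : DerivAE T p.m (fun t => -p.u t)
  s_zero : p.s 0 = 0
  x_zero : p.x 0 = 0
  m_zero : p.m 0 = m₀
  m_final : mT ≤ p.m T

/-- The constants `(α₀, α, β_s, β_x, β_m)` and costate functions `ψ_s, ψ_x, ψ_m`. -/
structure Multipliers where
  α₀ : ℝ
  α : ℝ
  βs : ℝ
  βx : ℝ
  βm : ℝ
  ψs : ℝ → ℝ
  ψx : ℝ → ℝ
  ψm : ℝ → ℝ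

/-- The Pontryagin function `H = ψ_s x + ψ_x (u - φ(x) - g) - ψ_m u` at time `t`, along the
trajectory `p`, with the control value `v`. -/
def pontryaginFunction (φ : ℝ → ℝ) (g : ℝ) (p : Trajectory) (q : Multipliers) (t v : ℝ) : ℝ :=
  q.ψs t * p.x t + q.ψx t * (v - φ (p.x t) - g) - q.ψm t * v

/-- The process `p` satisfies the Pontryagin maximum principle with the multipliers `q`. -/
structure SatisfiesMP (φ : ℝ → ℝ) (g T mT : ℝ) (p : Trajectory) (q : Multipliers) : Prop where
  lipschitz_ψs : ∃ K, LipschitzOnWith K q.ψs (Icc 0 T)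
  lipschitz_ψx : ∃ K, LipschitzOnWith K q.ψx (Icc 0 T)
  lipschitz_ψm : ∃ K, LipschitzOnWith K q.ψm (Icc 0 T)
  nonneg_α₀ : 0 ≤ q.α₀
  nonneg_α : 0 ≤ q.α
  nontrivial : ¬ (q.α₀ = 0 ∧ q.α = 0 ∧ q.βs = 0 ∧ q.βx = 0 ∧ q.βm = 0)
  slackness : q.α * (p.m T - mT) = 0
  adjoint_s : DerivAE T q.ψs (fun _ => 0)
  adjoint_x : DerivAE T q.ψx (fun t => -(q.ψs t - q.ψx t * deriv φ (p.x t)))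
  adjoint_m : DerivAE T q.ψm (fun _ => 0)
  transversality_s : q.ψs 0 = q.βs ∧ q.ψs T = q.α₀
  transversality_x : q.ψx 0 = q.βx ∧ q.ψx T = 0
  transversality_m : q.ψm 0 = q.βm ∧ q.ψm T = q.α
  energy : ∃ h : ℝ, ∀ᵐ t : ℝ, t ∈ Ioo 0 T → pontryaginFunction φ g p q t (p.u t) = h
  maximality : ∀ᵐ t : ℝ, t ∈ Ioo 0 T → ∀ v ∈ Icc (0 : ℝ) 1,
    pontryaginFunction φ g p q t v ≤ pontryaginFunction φ g p q t (p.u t)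

/-- A Pontryagin extremal: an admissible process together with multipliers with which it satisfies
the maximum principle. -/
structure IsPontryaginExtremal (φ : ℝ → ℝ) (g T m₀ mT : ℝ) (p : Trajectory) (q : Multipliers) :
    Prop where
  admissible : IsAdmissible φ g T m₀ mT p
  maximumPrinciple : SatisfiesMP φ g T mT p q

/-- `u = v` on the interval `]a, b[` (almost everywhere, as for any measurable control). -/
def ControlEq (p : Trajectory) (a b v : ℝ) : Prop :=
  ∀ᵐ t : ℝ, t ∈ Ioo a b → p.u t = v

/-- A singular arc on `]a, b[`: the switching function `ψ_x - α` vanishes there, the velocity is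
constant, and the control is `u_sing = φ(x) + g`. -/
def SingularArc (φ : ℝ → ℝ) (g : ℝ) (p : Trajectory) (q : Multipliers) (a b : ℝ) : Prop :=
  (∀ t ∈ Ioo a b, q.ψx t = q.α) ∧
  ∃ c : ℝ, (∀ t ∈ Ioo a b, p.x t = c) ∧ ControlEq p a b (φ c + g)

/-- Names of the five types of extremals. -/
inductive ExtremalType where
  | Ia
  | Ib
  | IIa
  | IIb
  | III

open ExtremalType

/-- The control is of the given type, on consecutive nondegenerate intervals that fill `]0, T[`. -/
def HasType (φ : ℝ → ℝ) (g T : ℝ) (p : Trajectory) (q : Multipliers) : ExtremalType → Prop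
  | Ia => ∃ t₁, 0 < t₁ ∧ t₁ < T ∧ ControlEq p 0 t₁ 1 ∧ ControlEq p t₁ T 0
  | Ib => ∃ t₁ t₂, 0 < t₁ ∧ t₁ < t₂ ∧ t₂ < T ∧
      ControlEq p 0 t₁ 1 ∧ SingularArc φ g p q t₁ t₂ ∧ ControlEq p t₂ T 0
  | IIa => ∃ t₁ t₂, 0 < t₁ ∧ t₁ < t₂ ∧ t₂ < T ∧
      ControlEq p 0 t₁ 0 ∧ ControlEq p t₁ t₂ 1 ∧ ControlEq p t₂ T 0
  | IIb => ∃ t₁ t₂ t₃, 0 < t₁ ∧ t₁ < t₂ ∧ t₂ < t₃ ∧ t₃ < T ∧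
      ControlEq p 0 t₁ 0 ∧ ControlEq p t₁ t₂ 1 ∧ SingularArc φ g p q t₂ t₃ ∧ ControlEq p t₃ T 0
  | III => ∃ t₁ t₂ t₃, 0 < t₁ ∧ t₁ < t₂ ∧ t₂ < t₃ ∧ t₃ < T ∧
      ControlEq p 0 t₁ 1 ∧ ControlEq p t₁ t₂ 0 ∧ ControlEq p t₂ t₃ 1 ∧ ControlEq p t₃ T 0

/-- The table of admitted types in each regime of `g`, the normalized multiplier `a = α / α₀`, and
the values `xmin`, `xmax`, `xs = x^∼`. Here `P S` is to be read as `the type is one of those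
in S`. -/
structure RegimeTable (P : Set ExtremalType → Prop) (φ : ℝ → ℝ) (g a xmin xmax xs : ℝ) :
    Prop where
  case_I_1_a : g < 1 / 2 → a ≤ xmax / (1 - g) → xmax ≤ xs → P {Ia}
  case_I_1_b : g < 1 / 2 → a ≤ xmax / (1 - g) → xs < xmax → -xs ≤ xmin → P {Ia, Ib}
  case_I_1_c : g < 1 / 2 → a ≤ xmax / (1 - g) → xs < xmax → xmin < -xs → P {Ia, Ib, IIa}
  case_I_2_a : g < 1 / 2 → xmax / (1 - g) ≤ a → a < -xmin / g → -xs ≤ xmin → P {Ia, Ib}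
  case_I_2_b : g < 1 / 2 → xmax / (1 - g) ≤ a → a < -xmin / g → xmin < -xs → P {Ia, Ib, IIa}
  case_I_3 : g < 1 / 2 → -xmin / g ≤ a → P {Ia, Ib, IIa, IIb, III}
  case_II_1_a : g = 1 / 2 → a ≤ 2 * xmax → xmax < xs → P {Ia}
  case_II_1_b : g = 1 / 2 → a ≤ 2 * xmax → xs ≤ xmax → P {Ia, Ib, IIa}
  case_II_2 : g = 1 / 2 → 2 * xmax < a → P {Ia, Ib, IIa, IIb, III}
  case_III_1_a : 1 / 2 < g → a ≤ -xmin / g → -xs ≤ xmin → (∀ y, φ (-y) = -φ y) → P {Ia}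
  case_III_1_b : 1 / 2 < g → a ≤ -xmin / g → xmin < -xs → xmax ≤ xs → P {Ia}
  case_III_1_c : 1 / 2 < g → a ≤ -xmin / g → xs < xmax → P {Ia, Ib}
  case_III_2_a : 1 / 2 < g → -xmin / g < a → a ≤ xmax / (1 - g) → xmax ≤ xs → P {Ia, IIa}
  case_III_2_b : 1 / 2 < g → -xmin / g < a → a ≤ xmax / (1 - g) → xs < xmax →
    P {Ia, Ib, IIa, IIb, III}
  case_III_3 : 1 / 2 < g → xmax / (1 - g) < a → P {Ia, Ib, IIa, IIb, III}

/-! Every extremal is already of type Ia or Ib, and this settles the whole table. Since `H` is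
affine in the control with slope `ψx - α`, the thrust is 1 where `ψx > α` and 0 where `ψx < α`.
Write `F y = α₀ y - α (φ y + g)`, which is `H` at the threshold `ψx = α`. Constancy of the maximized
`H`, together with `-g < φ (x t) < 1 - g`, gives `F (x t) ≤ c`, with equality exactly when `ψx t =
α` (`exists_switching_times`).

`F` is strictly convex on the negative half-line and strictly concave on the positive one. At the
last time `t₂` with `ψx = α`, convexity forces `x t₂ ≥ 0`. Concavity then forbids the velocity from
exceeding `x t₂`, because on such an excursion `ψx` would never meet `α` and `x` would be monotone
between equal end values. So the threshold is met only at the velocity `x t₂`, and `ψx` is above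
`α`, then equal to it, then below (`switching_structure`).

A nondegenerate singular arc has velocity `z > 0` with `φ' z = 1/a`, that is `z = x^∼`, and `z <
xmax`. Hence `xmax ≤ x^∼` leaves only Ia. -/

/-! ### Monotonicity from almost everywhere derivatives, and crossing times. -/

/-- An absolutely continuous function with a.e. nonnegative derivative has `f a ≤ f b`. -/
theorem AbsolutelyContinuousOnInterval.le_of_ae_deriv_nonneg {f : ℝ → ℝ} {a b : ℝ} (hab : a ≤ b)
    (hf : AbsolutelyContinuousOnInterval f a b)
    (hd : ∀ᵐ t : ℝ, t ∈ Ioo a b → ∃ d, HasDerivAt f d t ∧ 0 ≤ d) : f a ≤ f b := by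
  have h := hf.integral_deriv_eq_sub
  have h0 : 0 ≤ ∫ t in a..b, deriv f t := by
    rw [intervalIntegral.integral_of_le hab, integral_Ioc_eq_integral_Ioo]
    refine setIntegral_nonneg_of_ae_restrict ?_
    rw [Filter.EventuallyLE, ae_restrict_iff' measurableSet_Ioo]
    filter_upwards [hd] with t ht hmem
    obtain ⟨d, hd1, hd2⟩ := ht hmem
    simpa [hd1.deriv] using hd2
  linarith

theorem AbsolutelyContinuousOnInterval.mono_Icc {f : ℝ → ℝ} {a b c d : ℝ}
    (hf : AbsolutelyContinuousOnInterval f a b) (hac : a ≤ c) (hcd : c ≤ d) (hdb : d ≤ b) :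
    AbsolutelyContinuousOnInterval f c d := by
  apply hf.mono
  rw [uIcc_of_le hcd, uIcc_of_le (hac.trans (hcd.trans hdb))]
  exact Icc_subset_Icc hac hdb

/-- An absolutely continuous function with a.e. positive derivative has `f a < f b`. -/
theorem AbsolutelyContinuousOnInterval.lt_of_ae_deriv_pos {f : ℝ → ℝ} {a b : ℝ} (hab : a < b)
    (hf : AbsolutelyContinuousOnInterval f a b)
    (hd : ∀ᵐ t : ℝ, t ∈ Ioo a b → ∃ d, HasDerivAt f d t ∧ 0 < d) : f a < f b := by
  have mono : ∀ c d, a ≤ c → c ≤ d → d ≤ b → f c ≤ f d := fun c d hac hcd hdb => by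
    refine (hf.mono_Icc hac hcd hdb).le_of_ae_deriv_nonneg hcd ?_
    filter_upwards [hd] with t ht hmem
    obtain ⟨e, he, he'⟩ := ht ⟨hac.trans_lt hmem.1, hmem.2.trans_le hdb⟩
    exact ⟨e, he, he'.le⟩
  -- Equal end values make the monotone `f` constant, against a positive derivative at a single
  -- interior point.
  refine (mono a b le_rfl hab.le le_rfl).lt_of_ne fun heq => ?_
  obtain ⟨t, ht, hmem⟩ : ∃ t, (t ∈ Ioo a b → ∃ d, HasDerivAt f d t ∧ 0 < d) ∧ t ∈ Ioo a b := by
    obtain ⟨t, hmem, ht⟩ := (Measure.dense_of_ae hd).inter_open_nonempty _ isOpen_Ioo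
      (nonempty_Ioo.2 hab)
    exact ⟨t, ht, hmem⟩
  obtain ⟨d, hd1, hd2⟩ := ht hmem
  have hconst : f =ᶠ[nhds t] fun _ => f a := by
    filter_upwards [isOpen_Ioo.mem_nhds hmem] with r hr
    exact le_antisymm (heq ▸ mono r b hr.1.le hr.2.le le_rfl) (mono a r le_rfl hr.1.le hr.2.le)
  exact hd2.ne' (hd1.unique ((hasDerivAt_const t (f a)).congr_of_eventuallyEq hconst))

/-- The last time before `t` at which `f` takes the value `c`. -/
theorem exists_last_crossing {f : ℝ → ℝ} {a t c : ℝ} (hat : a ≤ t) (hf : ContinuousOn f (Icc a t))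
    (ha : f a ≤ c) (ht : c < f t) : ∃ t₀ ∈ Ico a t, f t₀ = c ∧ ∀ r ∈ Ioc t₀ t, c < f r := by
  have hcl : IsCompact {r ∈ Icc a t | f r ≤ c} := by
    have : {r ∈ Icc a t | f r ≤ c} = Icc a t ∩ f ⁻¹' Iic c := rfl
    rw [this]
    exact isCompact_Icc.of_isClosed_subset (hf.preimage_isClosed_of_isClosed isClosed_Icc isClosed_Iic)
      inter_subset_left
  obtain ⟨t₀, ⟨hmem, hle⟩, hub⟩ := hcl.exists_isGreatest ⟨a, left_mem_Icc.2 hat, ha⟩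
  have hlt : t₀ < t := hmem.2.lt_of_ne (by rintro rfl; linarith)
  have hgt : ∀ r ∈ Ioc t₀ t, c < f r := fun r hr => by
    by_contra! hcon
    exact absurd (hub ⟨⟨hmem.1.trans hr.1.le, hr.2⟩, hcon⟩) (not_le.2 hr.1)
  refine ⟨t₀, ⟨hmem.1, hlt⟩, hle.antisymm ?_, hgt⟩
  obtain ⟨r, hr, hrc⟩ := intermediate_value_Icc hlt.le (hf.mono (Icc_subset_Icc_left hmem.1))
    ⟨hle, ht.le⟩
  rcases hr.1.eq_or_lt with rfl | h
  · exact hrc.ge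
  · exact absurd hrc (hgt r ⟨h, hr.2⟩).ne'

/-- The first time after `t` at which `f` takes the value `c`. -/
theorem exists_first_crossing {f : ℝ → ℝ} {t b c : ℝ} (htb : t ≤ b) (hf : ContinuousOn f (Icc t b))
    (hb : f b ≤ c) (ht : c < f t) : ∃ t₁ ∈ Ioc t b, f t₁ = c ∧ ∀ r ∈ Ico t t₁, c < f r := by
  have hf' : ContinuousOn (fun r => f (-r)) (Icc (-b) (-t)) := by
    refine hf.comp continuousOn_neg fun r hr => ?_
    exact ⟨by linarith [hr.2], by linarith [hr.1]⟩
  obtain ⟨t₀, h1, h2, h3⟩ := exists_last_crossing (c := c) (neg_le_neg htb) hf' (by simpa using hb)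
    (by simpa using ht)
  refine ⟨-t₀, ⟨by linarith [h1.2], by linarith [h1.1]⟩, h2, fun r hr => ?_⟩
  simpa using h3 (-r) ⟨by linarith [hr.2], by linarith [hr.1]⟩

/-- A strictly concave function that is at most `f z` arbitrarily close to `z` on the right
is below `f z` everywhere on the right. -/
theorem StrictConcaveOn.lt_of_le_right {f : ℝ → ℝ} {s : Set ℝ} (hf : StrictConcaveOn ℝ s f)
    {z w y : ℝ} (hz : z ∈ s) (hy : y ∈ s) (hzw : z < w) (hwy : w < y) (hw : f w ≤ f z) :
    f y < f z := by
  by_contra! hcon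
  have := hf.lt_on_openSegment hz hy (hzw.trans hwy).ne
    (by rw [openSegment_eq_Ioo (hzw.trans hwy)]; exact ⟨hzw, hwy⟩)
  rw [min_eq_left hcon] at this
  linarith

/-! ### The order of the switching regimes. -/

/-- The structure of a switching function `ψ` with threshold `α` along a scalar motion `x` that
decreases where `ψ < α`, increases where `α < ψ`, and for which a convex-concave function `F` of
the state measures the distance of `ψ` from the threshold. -/
theorem switching_structure {x ψ F : ℝ → ℝ} {T α c : ℝ}
    (hx : ContinuousOn x (Icc 0 T)) (hψ : ContinuousOn ψ (Icc 0 T)) (hx0 : x 0 = 0) (hψT : ψ T < α)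
    (hdec : ∀ a b, 0 ≤ a → a < b → b ≤ T → (∀ r ∈ Ioo a b, ψ r < α) → x b < x a)
    (hinc : ∀ a b, 0 ≤ a → a < b → b ≤ T → (∀ r ∈ Ioo a b, α < ψ r) → x a < x b)
    (hconv : StrictConvexOn ℝ (Iic 0) F) (hconc : StrictConcaveOn ℝ (Ici 0) F)
    (hF : ∀ t ∈ Icc 0 T, F (x t) ≤ c) (hFeq : ∀ t ∈ Icc 0 T, (F (x t) = c ↔ ψ t = α))
    (hterm : ∀ t ∈ Icc 0 T, ψ t = α → x T < x t)
    (hex : ∃ t ∈ Icc 0 T, α ≤ ψ t) :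
    ∃ t₁ t₂, 0 ≤ t₁ ∧ t₁ ≤ t₂ ∧ t₂ < T ∧ (∀ t ∈ Ico 0 t₁, α < ψ t) ∧
      (∀ t ∈ Icc t₁ t₂, ψ t = α ∧ x t = x t₂) ∧ (∀ t ∈ Ioc t₂ T, ψ t < α) ∧ 0 ≤ x t₂ ∧
      ∃ y < x t₂, F y < F (x t₂) := by
  have hcompact : IsCompact (Icc 0 T ∩ ψ ⁻¹' Ici α) :=
    isCompact_Icc.of_isClosed_subset (hψ.preimage_isClosed_of_isClosed isClosed_Icc isClosed_Ici)
      inter_subset_left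
  obtain ⟨t₂, ⟨hm₂, hge₂⟩, hub₂⟩ := hcompact.exists_isGreatest hex
  have hlt₂ : t₂ < T := hm₂.2.lt_of_ne (by rintro rfl; exact absurd hge₂ (not_le.2 hψT))
  have hafter : ∀ t ∈ Ioc t₂ T, ψ t < α := fun t ht => by
    by_contra! hcon
    exact absurd (hub₂ ⟨⟨hm₂.1.trans ht.1.le, ht.2⟩, hcon⟩) (not_le.2 ht.1)
  have heq₂ : ψ t₂ = α := by
    by_contra hne
    obtain ⟨r, hr, hrα, -⟩ := exists_first_crossing hlt₂.le (hψ.mono (Icc_subset_Icc_left hm₂.1))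
      hψT.le (lt_of_le_of_ne hge₂ (Ne.symm hne))
    exact (hafter r hr).ne hrα
  have hF₂ : F (x t₂) = c := (hFeq t₂ hm₂).2 heq₂
  have hxT : x T < x t₂ := hterm t₂ hm₂ heq₂
  -- After `t₂` the state takes every value in this interval while `ψ` stays off the threshold.
  have hbelow : ∀ y ∈ Ico (x T) (x t₂), F y < c := fun y hy => by
    obtain ⟨r, hr, hrx⟩ := intermediate_value_Icc' hlt₂.le (hx.mono (Icc_subset_Icc_left hm₂.1))
      ⟨hy.1, hy.2.le⟩
    have hr₂ : t₂ < r := hr.1.lt_of_ne (by rintro rfl; exact hy.2.ne' hrx)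
    have hrm : r ∈ Icc 0 T := ⟨hm₂.1.trans hr.1, hr.2⟩
    rw [← hrx]
    exact (hF r hrm).lt_of_ne fun h => (hafter r ⟨hr₂, hr.2⟩).ne ((hFeq r hrm).1 h)
  have hT0 : 0 ≤ T := hm₂.1.trans hm₂.2
  have hF0 : F 0 ≤ c := hx0 ▸ hF 0 (left_mem_Icc.2 hT0)
  have hlow : F (x T) < F (x t₂) := hF₂ ▸ hbelow _ ⟨le_rfl, hxT⟩
  have hpos : 0 ≤ x t₂ := by
    by_contra! hneg
    -- A convex `F` that has risen from `x T` to `x t₂ < 0` keeps rising, so `F 0 > c`, although the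
    -- motion starts at 0.
    have := hconv.convexOn.lt_right_of_left_lt (mem_Iic.2 (hxT.trans hneg).le) (mem_Iic.2 le_rfl)
      (by rw [openSegment_eq_Ioo (hxT.trans hneg)]; exact ⟨hxT, hneg⟩) hlow
    linarith
  have hle : ∀ t ∈ Icc 0 T, x t ≤ x t₂ := fun t ht => by
    by_contra! hgt
    obtain ⟨a, ha, hxa, hagt⟩ := exists_last_crossing ht.1 (hx.mono (Icc_subset_Icc_right ht.2))
      (hx0.trans_le hpos) hgt
    obtain ⟨b, hb, hxb, hbgt⟩ := exists_first_crossing ht.2 (hx.mono (Icc_subset_Icc_left ht.1))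
      hxT.le hgt
    have hab : a < b := ha.2.trans hb.1
    have hsub : Icc a b ⊆ Icc 0 T := Icc_subset_Icc ha.1 hb.2
    have hgt' : ∀ r ∈ Ioo a b, x t₂ < x r := fun r hr => by
      rcases le_total r t with h | h
      · exact hagt r ⟨hr.1, h⟩
      · exact hbgt r ⟨h, hr.2⟩
    -- Values `w` between `x t₂` and `x r` are attained, so `F w ≤ c = F (x t₂)`; strict concavity
    -- then gives `F (x r) < c`.
    have hne : ∀ r ∈ Ioo a b, ψ r ≠ α := fun r hr h => by
      have hrm := hsub (Ioo_subset_Icc_self hr)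
      have hxr := hgt' r hr
      obtain ⟨w, hw⟩ := exists_between hxr
      obtain ⟨v, hv, hvw⟩ := intermediate_value_Icc hr.1.le
        (hx.mono ((Icc_subset_Icc_right hr.2.le).trans hsub))
        (show w ∈ Icc (x a) (x r) from ⟨hxa ▸ hw.1.le, hw.2.le⟩)
      have hFw : F w ≤ F (x t₂) := by
        rw [hF₂, ← hvw]
        exact hF v (hsub ⟨hv.1, hv.2.trans hr.2.le⟩)
      have := hconc.lt_of_le_right hpos (hpos.trans hxr.le) hw.1 hw.2 hFw
      rw [hF₂, (hFeq r hrm).2 h] at this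
      exact lt_irrefl _ this
    have htm : t ∈ Ioo a b := ⟨ha.2, hb.1⟩
    have hcont : ContinuousOn ψ (Ioo a b) := hψ.mono (Ioo_subset_Icc_self.trans hsub)
    rcases (hne t htm).lt_or_gt with hlt | hgtα
    · refine absurd (hdec a b ha.1 hab hb.2 fun r hr => ?_) (by rw [hxa, hxb]; exact lt_irrefl _)
      by_contra! hcon
      obtain ⟨v, hv, hvα⟩ := isPreconnected_Ioo.intermediate_value htm hr hcont ⟨hlt.le, hcon⟩
      exact hne v hv hvα
    · refine absurd (hinc a b ha.1 hab hb.2 fun r hr => ?_) (by rw [hxa, hxb]; exact lt_irrefl _)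
      by_contra! hcon
      obtain ⟨v, hv, hvα⟩ := isPreconnected_Ioo.intermediate_value hr htm hcont ⟨hcon, hgtα.le⟩
      exact hne v hv hvα
  have hstate : ∀ t ∈ Icc 0 T, ψ t = α → x t = x t₂ := fun t ht h => by
    refine (hle t ht).antisymm ?_
    by_contra! hcon
    exact (hbelow _ ⟨(hterm t ht h).le, hcon⟩).ne ((hFeq t ht).2 h)
  -- Below the threshold `x` would fall until the next crossing, where it equals its maximum `x t₂`.
  have hbefore : ∀ t ∈ Icc 0 t₂, α ≤ ψ t := fun t ht => by
    by_contra! hcon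
    obtain ⟨b, hb, hbα, hbgt⟩ := exists_first_crossing (f := fun r => -ψ r) (c := -α) ht.2
      (hψ.neg.mono (Icc_subset_Icc ht.1 hm₂.2)) (neg_le_neg heq₂.ge) (neg_lt_neg hcon)
    have hbT : b ≤ T := hb.2.trans hm₂.2
    have := hdec t b ht.1 hb.1 hbT fun r hr => neg_lt_neg_iff.1 (hbgt r ⟨hr.1.le, hr.2⟩)
    rw [hstate b ⟨ht.1.trans hb.1.le, hbT⟩ (neg_injective hbα)] at this
    exact absurd (hle t ⟨ht.1, ht.2.trans hm₂.2⟩) (not_le.2 this)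
  have hcompact' : IsCompact (Icc 0 T ∩ ψ ⁻¹' {α}) :=
    isCompact_Icc.of_isClosed_subset
      (hψ.preimage_isClosed_of_isClosed isClosed_Icc isClosed_singleton) inter_subset_left
  obtain ⟨t₁, ⟨hm₁, heq₁⟩, hlb₁⟩ := hcompact'.exists_isLeast ⟨t₂, hm₂, heq₂⟩
  have h₁₂ : t₁ ≤ t₂ := hlb₁ ⟨hm₂, heq₂⟩
  -- On a bump of `ψ` above `α`, `x` would increase strictly between two crossings with the same
  -- state.
  have hmid : ∀ t ∈ Icc t₁ t₂, ψ t = α := fun t ht => by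
    by_contra hne
    have hgt : α < ψ t := lt_of_le_of_ne (hbefore t ⟨hm₁.1.trans ht.1, ht.2⟩) (Ne.symm hne)
    obtain ⟨a, ha, hψa, hagt⟩ := exists_last_crossing ht.1
      (hψ.mono (Icc_subset_Icc hm₁.1 (ht.2.trans hm₂.2))) (le_of_eq heq₁) hgt
    obtain ⟨b, hb, hψb, hbgt⟩ := exists_first_crossing ht.2
      (hψ.mono (Icc_subset_Icc (hm₁.1.trans ht.1) hm₂.2)) heq₂.le hgt
    have ha0 : 0 ≤ a := hm₁.1.trans ha.1
    have hbT : b ≤ T := hb.2.trans hm₂.2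
    have hab : a < b := ha.2.trans hb.1
    have := hinc a b ha0 hab hbT fun r hr => by
      rcases le_total r t with h | h
      · exact hagt r ⟨hr.1, h⟩
      · exact hbgt r ⟨h, hr.2⟩
    rw [hstate a ⟨ha0, hab.le.trans hbT⟩ hψa, hstate b ⟨ha0.trans hab.le, hbT⟩ hψb] at this
    exact lt_irrefl _ this
  refine ⟨t₁, t₂, hm₁.1, h₁₂, hlt₂, fun t ht => ?_, fun t ht => ?_, hafter, hpos, x T, hxT, hlow⟩
  · refine lt_of_le_of_ne (hbefore t ⟨ht.1, ht.2.le.trans h₁₂⟩) fun h => ?_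
    exact absurd (hlb₁ ⟨⟨ht.1, ht.2.le.trans (h₁₂.trans hm₂.2)⟩, h.symm⟩) (not_le.2 ht.2)
  · exact ⟨hmid t ht, hstate t ⟨hm₁.1.trans ht.1, ht.2.trans hm₂.2⟩ (hmid t ht)⟩

/-! ### Comparison arguments for differential inequalities. -/

theorem AbsolutelyContinuousOnInterval.sub_eq_of_ae_deriv_const {f : ℝ → ℝ} {a b k : ℝ}
    (hab : a ≤ b) (hf : AbsolutelyContinuousOnInterval f a b)
    (hd : ∀ᵐ t : ℝ, t ∈ Ioo a b → HasDerivAt f k t) : f b - f a = k * (b - a) := by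
  rw [← hf.integral_deriv_eq_sub, intervalIntegral.integral_of_le hab, integral_Ioc_eq_integral_Ioo,
    setIntegral_congr_ae (g := fun _ => k) measurableSet_Ioo
      (by filter_upwards [hd] with t ht hmem using (ht hmem).deriv)]
  simp [hab, mul_comm]

/-- A positive function that decays at most exponentially as long as it is positive
stays positive. -/
theorem AbsolutelyContinuousOnInterval.pos_of_ae_deriv_ge {y : ℝ → ℝ} {T K : ℝ}
    (hy : AbsolutelyContinuousOnInterval y 0 T) (h0 : 0 < y 0)
    (hd : ∀ᵐ t : ℝ, t ∈ Ioo 0 T → ∃ d, HasDerivAt y d t ∧ (0 ≤ y t → -(K * y t) ≤ d)) :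
    ∀ t ∈ Icc 0 T, 0 < y t := by
  intro t ht
  by_contra! hcon
  have hT : 0 ≤ T := ht.1.trans ht.2
  have hcont : ContinuousOn y (Icc 0 T) := uIcc_of_le hT ▸ hy.continuousOn
  obtain ⟨b, hb, hyb, hpos⟩ := exists_first_crossing ht.1 (hcont.mono (Icc_subset_Icc_right ht.2))
    hcon h0
  have hbT : b ≤ T := hb.2.trans ht.2
  have hexp : AbsolutelyContinuousOnInterval (fun r => Real.exp (K * r)) 0 b := by
    have hcd : ContDiff ℝ 1 fun r : ℝ => Real.exp (K * r) := by fun_prop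
    obtain ⟨C, hC⟩ := hcd.contDiffOn.exists_lipschitzOnWith one_ne_zero (convex_uIcc (0 : ℝ) b)
      isCompact_uIcc
    exact hC.absolutelyContinuousOnInterval
  -- With the integrating factor, `y r * exp (K r)` is nondecreasing up to the first zero `b`.
  have hz := ((hy.mono_Icc le_rfl hb.1.le hbT).fun_mul hexp).le_of_ae_deriv_nonneg hb.1.le (by
    filter_upwards [hd] with r hr hmem
    obtain ⟨d, hd1, hd2⟩ := hr ⟨hmem.1, hmem.2.trans_le hbT⟩
    have he : HasDerivAt (fun r => Real.exp (K * r)) (Real.exp (K * r) * K) r := by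
      simpa using ((hasDerivAt_id r).const_mul K).exp
    refine ⟨_, hd1.mul he, ?_⟩
    have h1 := hd2 (hpos r ⟨hmem.1.le, hmem.2⟩).le
    have h2 := mul_nonneg (Real.exp_pos (K * r)).le (show 0 ≤ d + K * y r by linarith)
    linarith)
  simp only [hyb, mul_zero, Real.exp_zero, mul_one, zero_mul] at hz
  linarith

/-- A solution of `y' = -c + b y` with `b > 0`, `c ≥ 0` and `y(T) = 0` is nonnegative. -/
theorem nonneg_of_linear_ode {y b : ℝ → ℝ} {T c : ℝ} (hy : AbsolutelyContinuousOnInterval y 0 T)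
    (hc : 0 ≤ c) (hb : ∀ t, 0 < b t) (hT : y T = 0)
    (hd : DerivAE T y fun t => -c + b t * y t) : ∀ t ∈ Icc 0 T, 0 ≤ y t := by
  intro t ht
  by_contra! hcon
  have hcont : ContinuousOn y (Icc 0 T) := uIcc_of_le (ht.1.trans ht.2) ▸ hy.continuousOn
  obtain ⟨s, hs, hys, hneg⟩ := exists_first_crossing (f := fun r => -y r) (c := 0) ht.2
    (hcont.neg.mono (Icc_subset_Icc_left ht.1)) (by simp [hT]) (neg_pos.2 hcon)
  -- While `y` is negative so is its derivative, hence it cannot climb back to 0.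
  have := (hy.mono_Icc ht.1 hs.1.le hs.2).neg.lt_of_ae_deriv_pos hs.1 (by
    filter_upwards [hd] with r hr hmem
    refine ⟨_, (hr ⟨ht.1.trans_lt hmem.1, hmem.2.trans_le hs.2⟩).neg, ?_⟩
    have := mul_pos (hb r) (hneg r ⟨hmem.1.le, hmem.2⟩)
    linarith)
  have h1 : -y t < -y s := this
  linarith

/-! ### Convexity and growth of the friction function. -/

namespace IsFriction

variable {φ : ℝ → ℝ}

/-- The second derivative is needed only in the interior; continuity includes the endpoint 0, where
`φ''` need not exist. -/
theorem strictConvexOn (hφ : IsFriction φ) : StrictConvexOn ℝ (Ici 0) φ := by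
  refine strictConvexOn_of_deriv2_pos (convex_Ici 0) hφ.differentiable.continuous.continuousOn ?_
  intro x hx
  rw [interior_Ici] at hx
  exact hφ.deriv_deriv_pos x hx

theorem strictConcaveOn (hφ : IsFriction φ) : StrictConcaveOn ℝ (Iic 0) φ := by
  refine strictConcaveOn_of_deriv2_neg (convex_Iic 0) hφ.differentiable.continuous.continuousOn ?_
  intro x hx
  rw [interior_Iic] at hx
  exact hφ.deriv_deriv_neg x hx

theorem strictMonoOn_deriv (hφ : IsFriction φ) : StrictMonoOn (deriv φ) (Ici 0) :=
  hφ.strictConvexOn.strictMonoOn_deriv fun x _ => hφ.differentiable x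

theorem strictAntiOn_deriv (hφ : IsFriction φ) : StrictAntiOn (deriv φ) (Iic 0) :=
  hφ.strictConcaveOn.strictAntiOn_deriv fun x _ => hφ.differentiable x

theorem strictMono (hφ : IsFriction φ) : StrictMono φ := strictMono_of_deriv_pos hφ.deriv_pos

theorem deriv_zero_le (hφ : IsFriction φ) (x : ℝ) : deriv φ 0 ≤ deriv φ x := by
  rcases le_total 0 x with h | h
  · exact hφ.strictMonoOn_deriv.monotoneOn self_mem_Ici h h
  · exact hφ.strictAntiOn_deriv.antitoneOn h self_mem_Iic h

/-- Since `φ' ≥ φ' 0 > 0`, `φ` grows at least linearly in both directions. -/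
theorem surjective (hφ : IsFriction φ) : Function.Surjective φ := by
  intro c
  have hk := hφ.deriv_pos 0
  have hR : 0 ≤ |c| / deriv φ 0 := by positivity
  have hmv : ∀ x y, x ≤ y → deriv φ 0 * (y - x) ≤ φ y - φ x := fun x y hxy =>
    mul_sub_le_image_sub_of_le_deriv hφ.differentiable hφ.deriv_zero_le hxy
  have h1 := hmv _ _ hR
  have h2 := hmv _ _ (neg_nonpos.2 hR)
  have h3 : deriv φ 0 * (|c| / deriv φ 0) = |c| := mul_div_cancel₀ _ hk.ne'
  rw [hφ.zero] at h1 h2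
  refine mem_range_of_exists_le_of_exists_ge hφ.differentiable.continuous
    ⟨-(|c| / deriv φ 0), ?_⟩ ⟨|c| / deriv φ 0, ?_⟩
  · linarith [neg_abs_le c]
  · linarith [le_abs_self c]

/-- `φ'` decreases and then increases, so its maximum over the interval is at an endpoint. -/
theorem exists_lipschitz_bound (hφ : IsFriction φ) (R : ℝ) :
    ∃ K, ∀ x ∈ Icc (-R) R, ∀ y ∈ Icc (-R) R, x ≤ y → φ y - φ x ≤ K * (y - x) := by
  refine ⟨max (deriv φ R) (deriv φ (-R)), ?_⟩
  refine (convex_Icc (-R) R).image_sub_le_mul_sub_of_deriv_le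
    hφ.differentiable.continuous.continuousOn hφ.differentiable.differentiableOn fun x hx => ?_
  have hx' := interior_subset hx
  rcases le_total 0 x with h | h
  · exact le_max_of_le_left (hφ.strictMonoOn_deriv.monotoneOn h (mem_Ici.2 (h.trans hx'.2)) hx'.2)
  · exact le_max_of_le_right (hφ.strictAntiOn_deriv.antitoneOn (mem_Iic.2 (hx'.1.trans h)) h hx'.1)

variable {α₀ α g : ℝ}

theorem strictConvexOn_sub (hφ : IsFriction φ) (hα : 0 < α) :
    StrictConvexOn ℝ (Iic 0) fun y => α₀ * y - α * (φ y + g) := by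
  refine ⟨convex_Iic 0, fun x hx y hy hne a b ha hb hab => ?_⟩
  have h := mul_pos hα (sub_pos.2 (hφ.strictConcaveOn.2 hx hy hne ha hb hab))
  obtain rfl : b = 1 - a := by linarith
  simp only [smul_eq_mul] at h ⊢
  linarith

theorem strictConcaveOn_sub (hφ : IsFriction φ) (hα : 0 < α) :
    StrictConcaveOn ℝ (Ici 0) fun y => α₀ * y - α * (φ y + g) := by
  refine ⟨convex_Ici 0, fun x hx y hy hne a b ha hb hab => ?_⟩
  have h := mul_pos hα (sub_pos.2 (hφ.strictConvexOn.2 hx hy hne ha hb hab))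
  obtain rfl : b = 1 - a := by linarith
  simp only [smul_eq_mul] at h ⊢
  linarith

/-- A critical point of `α₀ y - α (φ(y) + g)` that is not a strict minimum from the left is not
the origin. -/
theorem ne_zero_of_critical (hφ : IsFriction φ) (hα : 0 < α) {y z : ℝ} (hyz : y < z)
    (hlt : α₀ * y - α * (φ y + g) < α₀ * z - α * (φ z + g)) (hcrit : α₀ = α * deriv φ z) :
    z ≠ 0 := by
  rintro rfl
  -- If `z = 0`, the difference of the two values in `hlt` is `α (φ' 0 - φ' ξ) (0 - y)` with `y < ξ
  -- < 0`, which is negative.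
  obtain ⟨ξ, hξ, hslope⟩ := exists_deriv_eq_slope φ hyz hφ.differentiable.continuous.continuousOn
    hφ.differentiable.differentiableOn
  have h1 := hφ.strictAntiOn_deriv (mem_Iic.2 hξ.2.le) self_mem_Iic hξ.2
  rw [eq_div_iff (sub_pos.2 hyz).ne'] at hslope
  have h2 := mul_pos (mul_pos hα (sub_pos.2 h1)) (sub_pos.2 hyz)
  subst hcrit
  have h3 : α * (deriv φ ξ * (0 - y)) = α * (φ 0 - φ y) := by rw [hslope]
  linarith

end IsFriction

/-! ### Costates, the bang-bang law and positivity of the multipliers. -/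

namespace IsPontryaginExtremal

variable {φ : ℝ → ℝ} {g T m₀ mT : ℝ} {p : Trajectory} {q : Multipliers}

theorem continuousOn_x (h : IsPontryaginExtremal φ g T m₀ mT p q) (hT : 0 ≤ T) :
    ContinuousOn p.x (Icc 0 T) := uIcc_of_le hT ▸ h.admissible.ac_x.continuousOn

theorem ac_ψx (h : IsPontryaginExtremal φ g T m₀ mT p q) (hT : 0 ≤ T) :
    AbsolutelyContinuousOnInterval q.ψx 0 T := by
  obtain ⟨K, hK⟩ := h.maximumPrinciple.lipschitz_ψx
  exact LipschitzOnWith.absolutelyContinuousOnInterval (uIcc_of_le hT ▸ hK)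

theorem ψs_eq (h : IsPontryaginExtremal φ g T m₀ mT p q) :
    ∀ t ∈ Icc 0 T, q.ψs t = q.α₀ := fun t ht => by
  obtain ⟨K, hK⟩ := h.maximumPrinciple.lipschitz_ψs
  have hac : AbsolutelyContinuousOnInterval q.ψs t T :=
    LipschitzOnWith.absolutelyContinuousOnInterval
      (uIcc_of_le ht.2 ▸ hK.mono (Icc_subset_Icc_left ht.1))
  have := hac.sub_eq_of_ae_deriv_const (k := 0) ht.2 (by
    filter_upwards [h.maximumPrinciple.adjoint_s] with r hr hmem
    exact hr ⟨ht.1.trans_lt hmem.1, hmem.2⟩)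
  linarith [h.maximumPrinciple.transversality_s.2]

theorem ψm_eq (h : IsPontryaginExtremal φ g T m₀ mT p q) :
    ∀ t ∈ Icc 0 T, q.ψm t = q.α := fun t ht => by
  obtain ⟨K, hK⟩ := h.maximumPrinciple.lipschitz_ψm
  have hac : AbsolutelyContinuousOnInterval q.ψm t T :=
    LipschitzOnWith.absolutelyContinuousOnInterval
      (uIcc_of_le ht.2 ▸ hK.mono (Icc_subset_Icc_left ht.1))
  have := hac.sub_eq_of_ae_deriv_const (k := 0) ht.2 (by
    filter_upwards [h.maximumPrinciple.adjoint_m] with r hr hmem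
    exact hr ⟨ht.1.trans_lt hmem.1, hmem.2⟩)
  linarith [h.maximumPrinciple.transversality_m.2]

theorem deriv_ψx (h : IsPontryaginExtremal φ g T m₀ mT p q) :
    DerivAE T q.ψx fun t => -q.α₀ + deriv φ (p.x t) * q.ψx t := by
  filter_upwards [h.maximumPrinciple.adjoint_x] with t ht hmem
  convert ht hmem using 1
  rw [h.ψs_eq t (Ioo_subset_Icc_self hmem)]
  ring

theorem ae_maximality (h : IsPontryaginExtremal φ g T m₀ mT p q) :
    ∀ᵐ t : ℝ, t ∈ Ioo 0 T → ∀ v ∈ Icc (0 : ℝ) 1,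
      (q.ψx t - q.α) * v ≤ (q.ψx t - q.α) * p.u t := by
  filter_upwards [h.maximumPrinciple.maximality] with t ht hmem v hv
  have := ht hmem v hv
  simp only [pontryaginFunction, h.ψm_eq t (Ioo_subset_Icc_self hmem)] at this
  linarith

theorem ae_control_eq_one (h : IsPontryaginExtremal φ g T m₀ mT p q) :
    ∀ᵐ t : ℝ, t ∈ Ioo 0 T → q.α < q.ψx t → p.u t = 1 := by
  filter_upwards [h.ae_maximality, h.admissible.control] with t ht hu hmem hlt
  exact le_antisymm (hu hmem).2
    (le_of_mul_le_mul_left (ht hmem 1 ⟨zero_le_one, le_rfl⟩) (sub_pos.2 hlt))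

theorem ae_control_eq_zero (h : IsPontryaginExtremal φ g T m₀ mT p q) :
    ∀ᵐ t : ℝ, t ∈ Ioo 0 T → q.ψx t < q.α → p.u t = 0 := by
  filter_upwards [h.ae_maximality, h.admissible.control] with t ht hu hmem hlt
  refine le_antisymm ?_ (hu hmem).1
  have := ht hmem 0 ⟨le_rfl, zero_le_one⟩
  nlinarith [(hu hmem).1]

theorem controlEq_one (h : IsPontryaginExtremal φ g T m₀ mT p q) {a b : ℝ} (ha : 0 ≤ a)
    (hb : b ≤ T) (hψ : ∀ t ∈ Ioo a b, q.α < q.ψx t) : ControlEq p a b 1 := by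
  filter_upwards [h.ae_control_eq_one] with t ht hmem
  exact ht ⟨ha.trans_lt hmem.1, hmem.2.trans_le hb⟩ (hψ t hmem)

theorem controlEq_zero (h : IsPontryaginExtremal φ g T m₀ mT p q) {a b : ℝ} (ha : 0 ≤ a)
    (hb : b ≤ T) (hψ : ∀ t ∈ Ioo a b, q.ψx t < q.α) : ControlEq p a b 0 := by
  filter_upwards [h.ae_control_eq_zero] with t ht hmem
  exact ht ⟨ha.trans_lt hmem.1, hmem.2.trans_le hb⟩ (hψ t hmem)

theorem mass_of_controlEq (h : IsPontryaginExtremal φ g T m₀ mT p q) (hT : 0 ≤ T) {v : ℝ}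
    (hu : ControlEq p 0 T v) : p.m T = m₀ - v * T := by
  have := h.admissible.ac_m.sub_eq_of_ae_deriv_const (k := -v) hT (by
    filter_upwards [hu, h.admissible.ode_m] with t hu hm hmem
    simpa only [hu hmem] using hm hmem)
  rw [h.admissible.m_zero] at this
  linarith

/-- When `α > 0`, slackness forces all the fuel to be burnt. -/
theorem not_controlEq_zero (h : IsPontryaginExtremal φ g T m₀ mT p q) (hT : 0 ≤ T)
    (hΔ : 0 < m₀ - mT) (hα : 0 < q.α) : ¬ ControlEq p 0 T 0 := fun hu => by
  have h1 := h.mass_of_controlEq hT hu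
  have h2 := (mul_eq_zero.1 h.maximumPrinciple.slackness).resolve_left hα.ne'
  linarith

/-- If `α₀ = 0`, the adjoint equation is homogeneous with zero final value, so `ψx ≡ 0`.
Nontriviality then leaves `α > 0`, and the engine would never be on. -/
theorem α₀_pos (h : IsPontryaginExtremal φ g T m₀ mT p q) (hφ : IsFriction φ) (hT : 0 ≤ T)
    (hΔ : 0 < m₀ - mT) : 0 < q.α₀ := by
  refine h.maximumPrinciple.nonneg_α₀.lt_of_ne fun h0 => ?_
  have hder := h.deriv_ψx
  rw [← h0] at hder
  have hzero : ∀ t ∈ Icc 0 T, q.ψx t = 0 := fun t ht => by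
    have hTx := h.maximumPrinciple.transversality_x.2
    refine le_antisymm ?_ (nonneg_of_linear_ode (h.ac_ψx hT) le_rfl
      (fun t => hφ.deriv_pos (p.x t)) hTx hder t ht)
    have := nonneg_of_linear_ode (h.ac_ψx hT).neg le_rfl (fun t => hφ.deriv_pos (p.x t))
      (by simp [hTx]) (by
        filter_upwards [hder] with r hr hmem
        refine (hr hmem).neg.congr_deriv ?_
        show -(-0 + deriv φ (p.x r) * q.ψx r) = -0 + deriv φ (p.x r) * -q.ψx r
        ring) t ht
    simpa using this
  have h0mem : (0 : ℝ) ∈ Icc 0 T := left_mem_Icc.2 hT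
  have hα : 0 < q.α := by
    refine h.maximumPrinciple.nonneg_α.lt_of_ne fun hα0 => h.maximumPrinciple.nontrivial
      ⟨h0.symm, hα0.symm, ?_, ?_, ?_⟩
    · rw [← h.maximumPrinciple.transversality_s.1, h.ψs_eq 0 h0mem, h0]
    · rw [← h.maximumPrinciple.transversality_x.1, hzero 0 h0mem]
    · rw [← h.maximumPrinciple.transversality_m.1, h.ψm_eq 0 h0mem, hα0]
  refine h.not_controlEq_zero hT hΔ hα (h.controlEq_zero le_rfl le_rfl fun t ht => ?_)
  rwa [hzero t (Ioo_subset_Icc_self ht)]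

/-- If `α = 0`, then `ψx ≥ 0`, and a zero at which the adjoint equation holds would be an interior
minimum with slope `-α₀ ≠ 0`. So full thrust lasts the whole time, which takes more fuel than is
available. -/
theorem α_pos (h : IsPontryaginExtremal φ g T m₀ mT p q) (hφ : IsFriction φ) (hT : 0 ≤ T)
    (hΔ₀ : 0 < m₀ - mT) (hΔ₁ : m₀ - mT < T) : 0 < q.α := by
  refine h.maximumPrinciple.nonneg_α.lt_of_ne fun hα0 => ?_
  have hα₀ := h.α₀_pos hφ hT hΔ₀
  have hnn := nonneg_of_linear_ode (h.ac_ψx hT) hα₀.le (fun t => hφ.deriv_pos (p.x t))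
    h.maximumPrinciple.transversality_x.2 h.deriv_ψx
  have hu : ControlEq p 0 T 1 := by
    filter_upwards [h.ae_control_eq_one, h.deriv_ψx] with t ht hd hmem
    refine ht hmem (hα0 ▸ (hnn t (Ioo_subset_Icc_self hmem)).lt_of_ne fun h0 => ?_)
    have hmin : IsLocalMin q.ψx t := by
      filter_upwards [isOpen_Ioo.mem_nhds hmem] with r hr
      exact h0 ▸ hnn r (Ioo_subset_Icc_self hr)
    have := hmin.hasDerivAt_eq_zero (hd hmem)
    rw [← h0] at this
    linarith
  have := h.mass_of_controlEq hT hu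
  linarith [h.admissible.m_final]

/-! ### Velocity bounds and the energy integral. -/

/-- The bounds are the equilibria of zero and full thrust. The distance to either decays at most
exponentially, so neither is reached; the strictness drives all later monotonicity and energy
estimates. -/
theorem velocity_bounds (h : IsPontryaginExtremal φ g T m₀ mT p q) (hφ : IsFriction φ)
    (hg₀ : 0 < g) (hg₁ : g < 1) (hT : 0 ≤ T) :
    ∀ t ∈ Icc 0 T, -g < φ (p.x t) ∧ φ (p.x t) < 1 - g := by
  have hac := h.admissible.ac_x
  obtain ⟨c, hc⟩ := hφ.surjective (-g)
  obtain ⟨d, hd⟩ := hφ.surjective (1 - g)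
  have hc0 : c < 0 := hφ.strictMono.lt_iff_lt.1 (by rw [hc, hφ.zero]; linarith)
  have hd0 : 0 < d := hφ.strictMono.lt_iff_lt.1 (by rw [hd, hφ.zero]; linarith)
  obtain ⟨C, hC⟩ := hac.exists_bound
  -- The radius is large enough to contain the trajectory and both equilibria `c` and `d`.
  rw [uIcc_of_le hT] at hC
  obtain ⟨K, hK⟩ := hφ.exists_lipschitz_bound (max C (max (-c) d))
  have hxm : ∀ t ∈ Icc 0 T, p.x t ∈ Icc (-max C (max (-c) d)) (max C (max (-c) d)) :=
    fun t ht => abs_le.1 ((hC t ht).trans (le_max_left _ _))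
  have hR := le_max_right C (max (-c) d)
  have hcm : c ∈ Icc (-max C (max (-c) d)) (max C (max (-c) d)) :=
    ⟨by linarith [le_max_left (-c) d], by linarith [le_max_right (-c) d]⟩
  have hdm : d ∈ Icc (-max C (max (-c) d)) (max C (max (-c) d)) :=
    ⟨by linarith [le_max_right (-c) d], by linarith [le_max_right (-c) d]⟩
  have hconst : ∀ k : ℝ, AbsolutelyContinuousOnInterval (fun _ => k) 0 T := fun k =>
    (LipschitzWith.const k).lipschitzOnWith.absolutelyContinuousOnInterval
  have hlow := (hac.sub (hconst c)).pos_of_ae_deriv_ge (K := K)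
    (by simp [h.admissible.x_zero, hc0]) (by
      filter_upwards [h.admissible.ode_x, h.admissible.control] with t ht hu hmem
      refine ⟨_, (ht hmem).sub (hasDerivAt_const t c), fun hnn => ?_⟩
      have hnn' : 0 ≤ p.x t - c := hnn
      have := hK c hcm _ (hxm t (Ioo_subset_Icc_self hmem)) (sub_nonneg.1 hnn')
      show -(K * (p.x t - c)) ≤ _
      linarith [(hu hmem).1])
  have hupp := ((hconst d).sub hac).pos_of_ae_deriv_ge (K := K)
    (by simp [h.admissible.x_zero, hd0]) (by
      filter_upwards [h.admissible.ode_x, h.admissible.control] with t ht hu hmem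
      refine ⟨_, (hasDerivAt_const t d).sub (ht hmem), fun hnn => ?_⟩
      have hnn' : 0 ≤ d - p.x t := hnn
      have := hK _ (hxm t (Ioo_subset_Icc_self hmem)) d hdm (sub_nonneg.1 hnn')
      show -(K * (d - p.x t)) ≤ _
      linarith [(hu hmem).2])
  intro t ht
  rw [← hc, ← hd]
  exact ⟨hφ.strictMono (sub_pos.1 (hlow t ht)), hφ.strictMono (sub_pos.1 (hupp t ht))⟩

theorem velocity_decreasing (h : IsPontryaginExtremal φ g T m₀ mT p q) (hφ : IsFriction φ)
    (hg₀ : 0 < g) (hg₁ : g < 1) (hT : 0 ≤ T) {a b : ℝ} (ha : 0 ≤ a) (hab : a < b) (hb : b ≤ T)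
    (hψ : ∀ t ∈ Ioo a b, q.ψx t < q.α) : p.x b < p.x a := by
  have := (h.admissible.ac_x.mono_Icc ha hab.le hb).neg.lt_of_ae_deriv_pos hab (by
    filter_upwards [h.admissible.ode_x, h.controlEq_zero ha hb hψ] with t ht hu hmem
    have hmem' : t ∈ Ioo 0 T := ⟨ha.trans_lt hmem.1, hmem.2.trans_le hb⟩
    refine ⟨_, (ht hmem').neg, ?_⟩
    rw [hu hmem]
    linarith [(h.velocity_bounds hφ hg₀ hg₁ hT t (Ioo_subset_Icc_self hmem')).1])
  exact neg_lt_neg_iff.1 this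

theorem velocity_increasing (h : IsPontryaginExtremal φ g T m₀ mT p q) (hφ : IsFriction φ)
    (hg₀ : 0 < g) (hg₁ : g < 1) (hT : 0 ≤ T) {a b : ℝ} (ha : 0 ≤ a) (hab : a < b) (hb : b ≤ T)
    (hψ : ∀ t ∈ Ioo a b, q.α < q.ψx t) : p.x a < p.x b := by
  refine (h.admissible.ac_x.mono_Icc ha hab.le hb).lt_of_ae_deriv_pos hab ?_
  filter_upwards [h.admissible.ode_x, h.controlEq_one ha hb hψ] with t ht hu hmem
  have hmem' : t ∈ Ioo 0 T := ⟨ha.trans_lt hmem.1, hmem.2.trans_le hb⟩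
  refine ⟨_, ht hmem', ?_⟩
  rw [hu hmem]
  linarith [(h.velocity_bounds hφ hg₀ hg₁ hT t (Ioo_subset_Icc_self hmem')).2]

/-- The maximized Pontryagin function is constant on the whole of `[0, T]`. -/
theorem exists_energy (h : IsPontryaginExtremal φ g T m₀ mT p q) (hφ : IsFriction φ)
    (hT : 0 < T) : ∃ c, ∀ t ∈ Icc 0 T,
      q.α₀ * p.x t - q.ψx t * (φ (p.x t) + g) + max (q.ψx t - q.α) 0 = c := by
  obtain ⟨c, hc⟩ := h.maximumPrinciple.energy
  refine ⟨c, fun t ht => ?_⟩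
  have hx := h.continuousOn_x hT.le
  have hψ : ContinuousOn q.ψx (Icc 0 T) := uIcc_of_le hT.le ▸ (h.ac_ψx hT.le).continuousOn
  have hφx : ContinuousOn (fun t => φ (p.x t)) (Icc 0 T) :=
    hφ.differentiable.continuous.comp_continuousOn hx
  -- With the control eliminated by the maximum, the expression is continuous, so the almost
  -- everywhere identity holds everywhere.
  refine Measure.eqOn_Icc_of_ae_eq (μ := volume)
    (f := fun t => q.α₀ * p.x t - q.ψx t * (φ (p.x t) + g) + max (q.ψx t - q.α) 0)
    (g := fun _ => c) hT.ne ?_ (((continuousOn_const.mul hx).sub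
      (hψ.mul (hφx.add continuousOn_const))).add
        (ContinuousOn.sup (hψ.sub continuousOn_const) continuousOn_const)) continuousOn_const ht
  rw [← Measure.restrict_congr_set Ioo_ae_eq_Icc, Filter.EventuallyEq,
    ae_restrict_iff' measurableSet_Ioo]
  filter_upwards [hc, h.ae_control_eq_one, h.ae_control_eq_zero] with r hr h1 h0 hmem
  have hE := hr hmem
  simp only [pontryaginFunction, h.ψs_eq r (Ioo_subset_Icc_self hmem),
    h.ψm_eq r (Ioo_subset_Icc_self hmem)] at hE
  rcases lt_trichotomy (q.ψx r) q.α with hlt | heq | hgt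
  · rw [h0 hmem hlt] at hE
    rw [max_eq_right (by linarith)]
    linarith
  · rw [heq] at hE ⊢
    rw [max_eq_right (by linarith)]
    linarith
  · rw [h1 hmem hgt] at hE
    rw [max_eq_left (by linarith)]
    linarith

/-- The thrust is maximal up to a time `t₁`, singular between `t₁` and `t₂` and zero afterwards. -/
theorem exists_switching_times (h : IsPontryaginExtremal φ g T m₀ mT p q) (hφ : IsFriction φ)
    (hg₀ : 0 < g) (hg₁ : g < 1) (hT : 0 < T) (hα₀ : 0 < q.α₀) (hα : 0 < q.α)
    (hu : ¬ ControlEq p 0 T 0) :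
    ∃ t₁ t₂, 0 ≤ t₁ ∧ t₁ ≤ t₂ ∧ t₂ < T ∧ (∀ t ∈ Ico 0 t₁, q.α < q.ψx t) ∧
      (∀ t ∈ Icc t₁ t₂, q.ψx t = q.α ∧ p.x t = p.x t₂) ∧ (∀ t ∈ Ioc t₂ T, q.ψx t < q.α) ∧
      0 ≤ p.x t₂ ∧ ∃ y < p.x t₂,
        q.α₀ * y - q.α * (φ y + g) < q.α₀ * p.x t₂ - q.α * (φ (p.x t₂) + g) := by
  obtain ⟨c, hc⟩ := h.exists_energy hφ hT
  have hψT := h.maximumPrinciple.transversality_x.2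
  have hcT : q.α₀ * p.x T = c := by
    have := hc T (right_mem_Icc.2 hT.le)
    rw [hψT, max_eq_right (by linarith)] at this
    linarith
  -- `F (x t) - c` equals `(ψx - α) (φ + g)` below the threshold and `(ψx - α) (φ + g - 1)` above
  -- it; both are negative.
  have hkey : ∀ t ∈ Icc 0 T, (q.ψx t ≠ q.α → q.α₀ * p.x t - q.α * (φ (p.x t) + g) < c) ∧
      (q.ψx t = q.α → q.α₀ * p.x t - q.α * (φ (p.x t) + g) = c) := fun t ht => by
    have hE := hc t ht
    obtain ⟨hb₀, hb₁⟩ := h.velocity_bounds hφ hg₀ hg₁ hT.le t ht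
    refine ⟨fun hne => ?_, fun heq => ?_⟩
    · rcases hne.lt_or_gt with hlt | hgt
      · rw [max_eq_right (by linarith)] at hE
        nlinarith
      · rw [max_eq_left (by linarith)] at hE
        nlinarith
    · rw [heq, max_eq_right (by linarith)] at hE
      linarith
  refine switching_structure (F := fun y => q.α₀ * y - q.α * (φ y + g)) (c := c)
    (h.continuousOn_x hT.le) (uIcc_of_le hT.le ▸ (h.ac_ψx hT.le).continuousOn)
    h.admissible.x_zero (hψT ▸ hα)
    (fun a b ha hab hb => h.velocity_decreasing hφ hg₀ hg₁ hT.le ha hab hb)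
    (fun a b ha hab hb => h.velocity_increasing hφ hg₀ hg₁ hT.le ha hab hb)
    (hφ.strictConvexOn_sub hα) (hφ.strictConcaveOn_sub hα) (fun t ht => ?_) (fun t ht => ⟨?_, ?_⟩)
    (fun t ht heq => ?_) ?_
  · by_cases heq : q.ψx t = q.α
    · exact ((hkey t ht).2 heq).le
    · exact ((hkey t ht).1 heq).le
  · exact fun hF => by_contra fun hne => ((hkey t ht).1 hne).ne hF
  · exact (hkey t ht).2
  -- Here `α₀ x t = c + α (φ (x t) + g) > c = α₀ x T`.
  · have h1 := (hkey t ht).2 heq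
    have h2 := mul_pos hα
      (show 0 < φ (p.x t) + g by linarith [(h.velocity_bounds hφ hg₀ hg₁ hT.le t ht).1])
    exact lt_of_mul_lt_mul_left (by linarith) hα₀.le
  · by_contra! hcon
    exact hu (h.controlEq_zero le_rfl le_rfl fun t ht => hcon t (Ioo_subset_Icc_self ht))

/-- On a nondegenerate interval where the switching function vanishes and the velocity is constant,
the arc is singular and the velocity is a critical point. -/
theorem singularArc_of_const (h : IsPontryaginExtremal φ g T m₀ mT p q) {a b z : ℝ}
    (ha : 0 ≤ a) (hab : a < b) (hb : b ≤ T) (hψ : ∀ t ∈ Ioo a b, q.ψx t = q.α)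
    (hx : ∀ t ∈ Ioo a b, p.x t = z) :
    SingularArc φ g p q a b ∧ q.α₀ = q.α * deriv φ z := by
  have hmem' : ∀ t ∈ Ioo a b, t ∈ Ioo 0 T := fun t ht =>
    ⟨ha.trans_lt ht.1, ht.2.trans_le hb⟩
  have hder : ∀ {f : ℝ → ℝ} {k : ℝ}, (∀ t ∈ Ioo a b, f t = k) → ∀ t ∈ Ioo a b,
      HasDerivAt f 0 t := fun hf t ht =>
    (hasDerivAt_const t _).congr_of_eventuallyEq
      (Filter.eventuallyEq_of_mem (isOpen_Ioo.mem_nhds ht) hf)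
  refine ⟨⟨hψ, z, hx, ?_⟩, ?_⟩
  · filter_upwards [h.admissible.ode_x] with t ht hmem
    have := (ht (hmem' t hmem)).unique (hder hx t hmem)
    rw [hx t hmem] at this
    linarith
  -- One point where the adjoint equation holds is enough: there `0 = -α₀ + φ' z * α`.
  · obtain ⟨t, hmem, ht⟩ := (Measure.dense_of_ae h.deriv_ψx).inter_open_nonempty _ isOpen_Ioo
      (nonempty_Ioo.2 hab)
    have := HasDerivAt.unique (ht (hmem' t hmem)) (hder hψ t hmem)
    simp only [hx t hmem, hψ t hmem] at this
    linarith

/-- Every extremal is of type `Ia`, or of type `Ib` with a singular velocity `z`. -/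
theorem hasType_Ia_or_Ib (h : IsPontryaginExtremal φ g T m₀ mT p q) (hφ : IsFriction φ)
    (hg₀ : 0 < g) (hg₁ : g < 1) (hΔ₀ : 0 < m₀ - mT) (hΔ₁ : m₀ - mT < T) :
    HasType φ g T p q Ia ∨
      HasType φ g T p q Ib ∧ ∃ z, 0 < z ∧ φ z < 1 - g ∧ q.α₀ = q.α * deriv φ z := by
  have hT : 0 < T := hΔ₀.trans hΔ₁
  have hα₀ := h.α₀_pos hφ hT.le hΔ₀
  have hα := h.α_pos hφ hT.le hΔ₀ hΔ₁
  have hu := h.not_controlEq_zero hT.le hΔ₀ hα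
  obtain ⟨t₁, t₂, h0, h12, h2T, hbefore, hmid, hafter, hz, y, hy, hFy⟩ :=
    h.exists_switching_times hφ hg₀ hg₁ hT hα₀ hα hu
  have hc₁ : ControlEq p 0 t₁ 1 :=
    h.controlEq_one le_rfl (h12.trans h2T.le) fun t ht => hbefore t ⟨ht.1.le, ht.2⟩
  have hc₂ : ControlEq p t₂ T 0 :=
    h.controlEq_zero (h0.trans h12) le_rfl fun t ht => hafter t ⟨ht.1, ht.2.le⟩
  rcases h12.eq_or_lt with rfl | hlt
  · refine .inl ⟨t₁, h0.lt_of_ne ?_, h2T, hc₁, hc₂⟩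
    rintro rfl
    exact hu hc₂
  · obtain ⟨hsing, hcrit⟩ := h.singularArc_of_const h0 hlt h2T.le
      (fun t ht => (hmid t (Ioo_subset_Icc_self ht)).1)
      (fun t ht => (hmid t (Ioo_subset_Icc_self ht)).2)
    have hzpos : 0 < p.x t₂ := hz.lt_of_ne' (hφ.ne_zero_of_critical hα hy hFy hcrit)
    refine .inr ⟨⟨t₁, t₂, h0.lt_of_ne ?_, hlt, h2T, hc₁, hsing, hc₂⟩, p.x t₂, hzpos,
      (h.velocity_bounds hφ hg₀ hg₁ hT.le t₂ ⟨h0.trans h12, h2T.le⟩).2, hcrit⟩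
    -- A singular arc starting at time 0 would have velocity `x 0 = 0`.
    rintro rfl
    exact hzpos.ne ((hmid 0 ⟨le_rfl, h12⟩).2 ▸ h.admissible.x_zero.symm)

end IsPontryaginExtremal

/-! ### Reading off the table. -/

theorem mainTheorem2 (φ : ℝ → ℝ) (hφ : IsFriction φ) (g T m₀ mT : ℝ)
    (hg₀ : 0 < g) (hg₁ : g < 1) (hΔ₀ : 0 < m₀ - mT) (hΔ₁ : m₀ - mT < T)
    (p : Trajectory) (q : Multipliers) (hpq : IsPontryaginExtremal φ g T m₀ mT p q) :
    0 < q.α₀ ∧ 0 < q.α ∧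
    (∃ τ : ExtremalType, HasType φ g T p q τ) ∧
    (∃! xmin : ℝ, -φ xmin - g = 0) ∧ (∃! xmax : ℝ, 1 - φ xmax - g = 0) ∧
    (∀ xmin xmax xs : ℝ, -φ xmin - g = 0 → 1 - φ xmax - g = 0 →
      0 ≤ xs → deriv φ xs = 1 / (q.α / q.α₀) →
      RegimeTable (fun S => ∃ τ ∈ S, HasType φ g T p q τ) φ g (q.α / q.α₀) xmin xmax xs) ∧
    (1 / (q.α / q.α₀) ≤ deriv φ 0 → HasType φ g T p q ExtremalType.Ia) := by
  have hT : 0 < T := hΔ₀.trans hΔ₁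
  have hα₀ := hpq.α₀_pos hφ hT.le hΔ₀
  have hα := hpq.α_pos hφ hT.le hΔ₀ hΔ₁
  have htype := hpq.hasType_Ia_or_Ib hφ hg₀ hg₁ hΔ₀ hΔ₁
  have hcrit : ∀ z, q.α₀ = q.α * deriv φ z → deriv φ z = 1 / (q.α / q.α₀) := fun z hz => by
    rw [one_div_div, hz, mul_div_cancel_left₀ _ hα.ne']
  refine ⟨hα₀, hα, ?_, ?_, ?_, fun xmin xmax xs hmin hmax hxs hds => ?_, fun h0 => ?_⟩
  · rcases htype with h | ⟨h, -⟩
    exacts [⟨_, h⟩, ⟨_, h⟩]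
  · obtain ⟨z, hz⟩ := hφ.surjective (-g)
    refine ⟨z, by simp [hz], fun y hy => hφ.strictMono.injective ?_⟩
    linarith
  · obtain ⟨z, hz⟩ := hφ.surjective (1 - g)
    refine ⟨z, by simp [hz], fun y hy => hφ.strictMono.injective ?_⟩
    linarith
  -- `φ'` is injective on the nonnegative half-line, so the singular velocity is `xs`, and the
  -- velocity bound puts it below `xmax`.
  · have hIb : HasType φ g T p q Ia ∨ HasType φ g T p q Ib ∧ xs < xmax := by
      refine htype.imp_right fun ⟨h, z, hz, hφz, hc⟩ => ⟨h, ?_⟩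
      have hzs : z = xs := hφ.strictMonoOn_deriv.injOn hz.le hxs ((hcrit z hc).trans hds.symm)
      rw [← hzs]
      exact hφ.strictMono.lt_iff_lt.1 (by linarith)
    have hA : ∀ S : Set ExtremalType, Ia ∈ S → xmax ≤ xs → ∃ τ ∈ S, HasType φ g T p q τ :=
      fun S hS hle => ⟨Ia, hS, hIb.resolve_right fun h => absurd h.2 (not_lt.2 hle)⟩
    have hAB : ∀ S : Set ExtremalType, Ia ∈ S → Ib ∈ S → ∃ τ ∈ S, HasType φ g T p q τ := by
      intro S hSa hSb
      rcases hIb with h | ⟨h, -⟩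
      exacts [⟨_, hSa, h⟩, ⟨_, hSb, h⟩]
    constructor
    case case_I_1_a => exact fun _ _ h => hA _ (by simp) h
    case case_II_1_a => exact fun _ _ h => hA _ (by simp) h.le
    case case_III_1_a =>
      intro hg _ hxmin hodd
      refine hA _ (by simp) ?_
      -- By oddness `φ (-xmin) = g > 1 - g = φ xmax`, so `xmax < -xmin ≤ xs`.
      have : xmax < -xmin := hφ.strictMono.lt_iff_lt.1 (by rw [hodd]; linarith)
      linarith
    case case_III_1_b => exact fun _ _ _ h => hA _ (by simp) h
    case case_III_2_a => exact fun _ _ _ h => hA _ (by simp) h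
    -- Each remaining row lists both Ia and Ib.
    all_goals intros; exact hAB _ (by simp) (by simp)
  · refine htype.resolve_right fun ⟨_, z, hz, _, hc⟩ => ?_
    have := hφ.strictMonoOn_deriv self_mem_Ici (mem_Ici.2 hz.le) hz
    rw [hcrit z hc] at this
    linarith
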